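/- All logarithms are base $2$, and the value $-1$ stands for logical TRUE, $+1$ for FALSE. For a partial Boolean function $f\colon D\to\{-1,1\}$ with $D\subseteq\{-1,1\}^n$ and $\varepsilon\ge 0$, let $\widetilde{\deg}_\varepsilon(f)$ be the least total degree of a real polynomial $p$ in $n$ variables with $|p(x)-f(x)|\le\varepsilon$ for all $x\in D$ (nothing is required outside $D$). Let $|x|$ denote the number of coordinates of $x$ equal to $-1$. For integers $N,R\ge 1$ and $F_R\colon\{-1,1\}^R\to\{-1,1\}$, let $G^{\le N}$ be the restriction of $$(x_1,\dots,x_R)\mapsto F_R(\mathsf{OR}_N(x_1),\dots,\mathsf{OR}_N(x_R)),\qquad x_i\in\{-1,1\}^N,$$ to the inputs $x=(x_1,\dots,x_R)$ with $|x|\le N$. Circuits are directed acyclic, with AND and OR gates of unbounded fan-in and with NOT gates; depth counts AND and OR gates but not NOT gates, and size is the number of nodes, input nodes included. A circuit is monotone if it has no NOT gates, and it has AND gates at the bottom if every gate that reads an input variable is an AND gate. A monotone DNF is an OR of terms, each an AND of unnegated variables, and its width is the largest number of variables in a term. **Theorem.** There is an absolute constant $C$ such that for all integers $N,R\ge 1$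 and every $F_R\colon\{-1,1\}^R\to\{-1,1\}$ there is a (total) function $$g\colon\{-1,1\}^{12\cdot N\cdot\lceil\log(R+1)\rceil}\to\{-1,1\}$$ such that for every $\varepsilon\ge 0$ $$\widetilde{\deg}_\varepsilon(g)\ \ge\ \widetilde{\deg}_\varepsilon(G^{\le N})\cdot\lceil\log(R+1)\rceil .$$ Moreover, the same function $g$ has the following properties. 1. If $F_R$ is computed by a circuit of depth $k$ and size $S$, then $g$ is computed by a circuit of depth at most $k+2$ and size at most $C\cdot S\cdot N\cdot R^{12}$. 2. If $F_R$ is computed by a monotone circuit of depth $k$ and size $S$, then $g$ is computed by a monotone circuit of depth at most $k+2$ with AND gates at the bottom and of size at most $C\cdot S\cdot N\cdot R^{12}$. 3. If $F_R$ is computed by a monotone DNF of width $w$, then $g$ is computed by a monotone DNF of width at most $C\cdot w\cdot\lceil\log(R+1)\rceil$ (which is $O(w\log R)$ for $R\ge 2$). -/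

import Mathlib

namespace ApproxDegree

/-! The cube `{-1,1}^ι` is the type `ι → ℤˣ`; the value `-1` is logical TRUE and `1` is FALSE. -/

/-- The `ε`-approximate degree of a partial function `f : D → {-1,1}` with domain
`D ⊆ {-1,1}^ι`: the least total degree of a real polynomial `p` with `|p(x) - f(x)| ≤ ε` for all
`x ∈ D` (nothing is required outside `D`). It is `⊤` if there is no such polynomial, which
cannot happen for `ε ≥ 0` and finite `ι`. -/
noncomputable def approxDeg {ι : Type} (D : Set (ι → ℤˣ)) (f : D → ℤˣ) (ε : ℝ) : ℕ∞ :=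
  ⨅ (p : MvPolynomial ι ℝ)
    (_ : ∀ x : D, |MvPolynomial.eval (fun i => ((x.1 i : ℤ) : ℝ)) p - ((f x : ℤ) : ℝ)| ≤ ε),
    (p.totalDegree : ℕ∞)

/-- The `ε`-approximate degree of a total function on `{-1,1}^ι`. -/
noncomputable def approxDegTotal {ι : Type} (f : (ι → ℤˣ) → ℤˣ) (ε : ℝ) : ℕ∞ :=
  approxDeg Set.univ (fun x => f x.1) ε

/-- The disjunction `OR_N` on `{-1,1}^N`. -/
def orFun (N : ℕ) (x : Fin N → ℤˣ) : ℤˣ := if ∃ j, x j = -1 then -1 else 1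

/-- Hamming weight: the number of coordinates equal to `-1`. -/
def hammingWeight {ι : Type} [Fintype ι] (x : ι → ℤˣ) : ℕ :=
  (Finset.univ.filter fun i => x i = -1).card

/-- The points of `({-1,1}^N)^R` of Hamming weight at most `N`. -/
def lowWeight (N R : ℕ) : Set (Fin R × Fin N → ℤˣ) := {x | hammingWeight x ≤ N}

/-- `G^{≤N}`: the block composition `F ∘ OR_N` restricted to inputs of Hamming weight
at most `N`. -/
def promiseComp (N R : ℕ) (F : (Fin R → ℤˣ) → ℤˣ) (x : lowWeight N R) : ℤˣ :=
  F fun i => orFun N fun j => x.1 (i, j)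

/-- A node of a Boolean circuit on `n` variables that comes after `s` earlier nodes: an input
variable, or a NOT gate, or an AND or OR gate of unbounded fan-in reading earlier nodes. -/
inductive Gate (n s : ℕ) : Type
  | input (v : Fin n)
  | not (j : Fin s)
  | and (J : Finset (Fin s))
  | or (J : Finset (Fin s))

/-- A Boolean circuit (a directed acyclic graph, listed in topological order) on `n` variables
with `s` nodes; `s` is its size. -/
inductive Circuit (n : ℕ) : ℕ → Type
  | nil : Circuit n 0
  | snoc {s : ℕ} (c : Circuit n s) (a : Gate n s) : Circuit n (s + 1)

/-- The value of a node on the input `x`, given the values `v` of the earlier nodes. -/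
def Gate.eval {n s : ℕ} (x : Fin n → ℤˣ) (v : Fin s → ℤˣ) : Gate n s → ℤˣ
  | .input i => x i
  | .not j => -v j
  | .and J => if ∀ j ∈ J, v j = -1 then -1 else 1
  | .or J => if ∃ j ∈ J, v j = -1 then -1 else 1

/-- The values of all nodes of a circuit on the input `x`. -/
def Circuit.eval {n : ℕ} (x : Fin n → ℤˣ) : {s : ℕ} → Circuit n s → Fin s → ℤˣ
  | _, .nil => Fin.elim0
  | _, .snoc c a => Fin.snoc (α := fun _ => ℤˣ) (c.eval x) (a.eval x (c.eval x))

/-- The circuit `c` with output node `o` computes `f`. -/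
def Circuit.Computes {n s : ℕ} (c : Circuit n s) (o : Fin s) (f : (Fin n → ℤˣ) → ℤˣ) : Prop :=
  ∀ x, c.eval x o = f x

/-- The depth of a node, given the depths of the earlier nodes: AND and OR gates are counted,
NOT gates are not. -/
def Gate.depth {n s : ℕ} (d : Fin s → ℕ) : Gate n s → ℕ
  | .input _ => 0
  | .not j => d j
  | .and J => J.sup d + 1
  | .or J => J.sup d + 1

/-- The depth of each node of a circuit: the largest number of AND and OR gates on a path
from it down to the bottom. The depth of a circuit is the depth of its output node. -/
def Circuit.depth {n : ℕ} : {s : ℕ} → Circuit n s → Fin s → ℕ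
  | _, .nil => Fin.elim0
  | _, .snoc c a => Fin.snoc (α := fun _ => ℕ) c.depth (a.depth c.depth)

/-- A circuit is monotone if it contains no NOT gates. -/
def Circuit.IsMonotone {n : ℕ} : {s : ℕ} → Circuit n s → Prop
  | _, .nil => True
  | _, .snoc c a => c.IsMonotone ∧ ∀ j, a ≠ .not j

/-- The node `i` of the circuit is an input variable. -/
def Circuit.IsInput {n : ℕ} : {s : ℕ} → Circuit n s → Fin s → Prop
  | _, .nil => Fin.elim0
  | _, .snoc c a => Fin.snoc (α := fun _ => Prop) c.IsInput (∃ v, a = .input v)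

/-- The circuit has AND gates at the bottom: every gate that reads an input variable is an
AND gate. -/
def Circuit.AndAtBottom {n : ℕ} : {s : ℕ} → Circuit n s → Prop
  | _, .nil => True
  | _, .snoc c a => c.AndAtBottom ∧
      match a with
      | .input _ => True
      | .not j => ¬ c.IsInput j
      | .and _ => True
      | .or J => ∀ j ∈ J, ¬ c.IsInput j

/-- A monotone DNF formula on `n` variables: a finite set of terms, each of them the conjunction
of a set of (unnegated) variables. -/
abbrev MonotoneDNF (n : ℕ) : Type := Finset (Finset (Fin n))

/-- The function computed by a monotone DNF. -/
def MonotoneDNF.eval {n : ℕ} (T : MonotoneDNF n) (x : Fin n → ℤˣ) : ℤˣ :=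
  if ∃ t ∈ T, ∀ v ∈ t, x v = -1 then -1 else 1

/-- The width of a monotone DNF: the largest number of variables in a term. -/
def MonotoneDNF.width {n : ℕ} (T : MonotoneDNF n) : ℕ := T.sup Finset.card

end ApproxDegree

namespace ApproxDegree
open Finset

/-! Put L = ⌈log(R+1)⌉. A point x of weight at most N can be stored in N slots, one slot for each
coordinate -1, holding the index of its block, and the remaining slots holding the padding symbol
`none`. A slot holding o is encoded by any point of a set V o in {-1,1}^{6L}. These sets are
disjoint and balanced: every monomial of degree below L has the same sum over each of them
(`exists_balanced_fibers`, from a Gilbert–Varshamov code). The function g decodes the slots and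
applies F to the bits "some slot holds i" (`blockLift`). Every code bit is supplied as two opposite
literals, so that decoding is monotone; this gives 12NL variables.

If p approximates g, average p over all permutations of the slots and all encodings. A monomial of p
factors over the slots, and by balance a slot in which its degree is below L contributes a constant.
At most deg p / L slots remain, and `isPolyOn_sum_perm` turns the average over permutations into a
polynomial of that degree in the numbers of slots holding each o. These numbers are affine in x on
inputs of low weight, so the degree drops by the factor L (`exists_approx_promiseComp`). -/

/-! ### Binary codes and balanced fibers. -/

/-- A Hamming ball of radius less than `L` in `𝔽₂^{6L}` has fewer than `2^{5L}` points. -/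
theorem card_ball_mul_lt {L : ℕ} (hL : 1 ≤ L) :
    #{v : Fin (6 * L) → ZMod 2 | #{b | v b ≠ 0} < L} * 2 ^ L < 2 ^ (6 * L) := by
  set B : Finset (Fin (6 * L) → ZMod 2) := {v | #{b | v b ≠ 0} < L} with hB
  -- Weigh a zero coordinate by 4 and a nonzero one by 1: the whole space has weight 5^{6L}, and a
  -- point of the ball, having at least 5L zeros, has weight at least 4^{5L}.
  have hsum : ∑ v : Fin (6 * L) → ZMod 2, ∏ b, (if v b ≠ 0 then 1 else 4) = 5 ^ (6 * L) := by
    have h := Finset.prod_univ_sum (fun _ : Fin (6 * L) => (Finset.univ : Finset (ZMod 2)))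
      (fun _ t => if t ≠ 0 then (1 : ℕ) else 4)
    rw [Fintype.piFinset_univ] at h
    rw [← h]
    have h5 : ∑ t : ZMod 2, (if t ≠ 0 then (1 : ℕ) else 4) = 5 := by decide
    simp only [h5, Finset.prod_const, Finset.card_univ, Fintype.card_fin]
  have hle : #B * 4 ^ (5 * L) ≤ 5 ^ (6 * L) := by
    rw [← hsum, ← smul_eq_mul]
    refine (Finset.card_nsmul_le_sum B _ _ fun v hv => ?_).trans
      (Finset.sum_le_sum_of_subset (Finset.subset_univ _))
    rw [Finset.prod_ite]
    simp only [Finset.prod_const, one_pow, one_mul]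
    refine Nat.pow_le_pow_right (by norm_num) ?_
    have h1 := Finset.card_filter_add_card_filter_not (s := (Finset.univ : Finset (Fin (6 * L))))
      (fun b => v b ≠ 0)
    have h2 : #{b | v b ≠ 0} < L := by simpa [hB] using hv
    simp only [Finset.card_univ, Fintype.card_fin] at h1
    omega
  have h4 : 0 < 4 ^ (5 * L) := by positivity
  refine Nat.lt_of_mul_lt_mul_right (a := 4 ^ (5 * L)) ?_
  calc #B * 2 ^ L * 4 ^ (5 * L) = #B * 4 ^ (5 * L) * 2 ^ L := by ring
    _ ≤ 5 ^ (6 * L) * 2 ^ L := Nat.mul_le_mul_right _ hle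
    -- Length 6L suffices because 5^6 · 2 = 31250 is less than 2^6 · 4^5 = 65536.
    _ = 31250 ^ L := by rw [pow_mul, ← mul_pow]; norm_num
    _ < 65536 ^ L := Nat.pow_lt_pow_left (by norm_num) (by omega)
    _ = 2 ^ (6 * L) * 4 ^ (5 * L) := by rw [pow_mul, pow_mul, ← mul_pow]; norm_num

/-- Gilbert–Varshamov: `k ≤ L` vectors of `𝔽₂^{6L}` all of whose nonempty subset sums have
Hamming weight at least `L`. -/
theorem exists_code {L : ℕ} (hL : 1 ≤ L) (k : ℕ) (hk : k ≤ L) :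
    ∃ r : ℕ → Fin (6 * L) → ZMod 2, ∀ A ⊆ Finset.range k, A.Nonempty →
      L ≤ #{b | (∑ i ∈ A, r i) b ≠ 0} := by
  induction k with
  | zero =>
    refine ⟨0, fun A hA hne => ?_⟩
    simp only [Finset.range_zero, Finset.subset_empty] at hA
    simp [hA] at hne
  | succ k ih =>
    obtain ⟨r, hr⟩ := ih (by omega)
    let B : Finset ℕ → Finset (Fin (6 * L) → ZMod 2) := fun A =>
      {v | #{b | (v + ∑ i ∈ A, r i) b ≠ 0} < L}
    have hBcard : ∀ A, #(B A) = #{v : Fin (6 * L) → ZMod 2 | #{b | v b ≠ 0} < L} := fun A => by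
      refine Finset.card_bij (fun v _ => v + ∑ i ∈ A, r i) (fun v hv => ?_)
        (fun v _ w _ h => add_right_cancel h) (fun w hw => ⟨w - ∑ i ∈ A, r i, ?_, by simp⟩)
      · simpa [B] using hv
      · simp only [B, Finset.mem_filter, Finset.mem_univ, true_and, sub_add_cancel]
        simpa using hw
    -- A new vector is bad only if it lies in the ball around one of the 2^k subset sums, and these
    -- balls do not cover the space.
    have hlt : #((Finset.range k).powerset.biUnion B) <
        #(Finset.univ : Finset (Fin (6 * L) → ZMod 2)) := by
      refine Finset.card_biUnion_le.trans_lt ?_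
      simp only [hBcard, Finset.sum_const, Finset.card_powerset, Finset.card_range, smul_eq_mul,
        Finset.card_univ, Fintype.card_pi, ZMod.card, Finset.prod_const, Fintype.card_fin]
      rw [mul_comm]
      exact (Nat.mul_le_mul_left _ (Nat.pow_le_pow_right (by norm_num) (by omega))).trans_lt
        (card_ball_mul_lt hL)
    obtain ⟨v, -, hv⟩ := Finset.exists_mem_notMem_of_card_lt_card hlt
    refine ⟨Function.update r k v, fun A hA hne => ?_⟩
    have hk' : ∀ A : Finset ℕ, A ⊆ Finset.range k →
        ∑ i ∈ A, Function.update r k v i = ∑ i ∈ A, r i := fun A hA =>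
      Finset.sum_congr rfl fun i hi => by
        have := Finset.mem_range.1 (hA hi)
        rw [Function.update_of_ne (by omega)]
    by_cases hkA : k ∈ A
    · have hsub : A.erase k ⊆ Finset.range k := fun i hi => by
        have h1 := Finset.mem_erase.1 hi
        have h2 := Finset.mem_range.1 (hA h1.2)
        exact Finset.mem_range.2 (by omega)
      have hnot : v ∉ B (A.erase k) := fun h =>
        hv (Finset.mem_biUnion.2 ⟨_, Finset.mem_powerset.2 hsub, h⟩)
      rw [← Finset.add_sum_erase _ _ hkA, hk' _ hsub, Function.update_self]
      simpa [B] using hnot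
    · have hsub : A ⊆ Finset.range k := fun i hi => by
        have h2 := Finset.mem_range.1 (hA hi)
        have : i ≠ k := fun h => hkA (h ▸ hi)
        exact Finset.mem_range.2 (by omega)
      rw [hk' _ hsub]
      exact hr A hsub hne

/-- A character sum over the cube vanishes as soon as one exponent is odd. -/
theorem sum_prod_pow_eq_zero {ι : Type} [Fintype ι] [DecidableEq ι] (k : ι → ℕ) {b : ι}
    (hb : Odd (k b)) : ∑ y : ι → ℤˣ, ∏ i, (y i : ℤ) ^ k i = 0 := by
  have h := Finset.prod_univ_sum (fun _ : ι => (Finset.univ : Finset ℤˣ))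
    (fun i t => (t : ℤ) ^ k i)
  rw [Fintype.piFinset_univ] at h
  rw [← h]
  refine Finset.prod_eq_zero (Finset.mem_univ b) ?_
  have hu : (Finset.univ : Finset ℤˣ) = {1, -1} := rfl
  rw [hu, Finset.sum_pair (by decide)]
  simp [hb.neg_one_pow]

/-- Disjoint sets of points of the cube `{-1,1}^{6L}`, one for each sign vector of length `L`,
over which all monomials of degree less than `L` have the same sum. -/
theorem exists_balanced_fibers {L : ℕ} (hL : 1 ≤ L) :
    ∃ H : (Fin (6 * L) → ℤˣ) → (Fin L → ℤˣ), ∀ k : Fin (6 * L) → ℕ, ∑ b, k b < L →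
      ∀ u : Fin L → ℤˣ, 2 ^ L * ∑ y with H y = u, ∏ b, (y b : ℤ) ^ k b =
        ∑ y : Fin (6 * L) → ℤˣ, ∏ b, (y b : ℤ) ^ k b := by
  obtain ⟨r, hr⟩ := exists_code hL L le_rfl
  refine ⟨fun y i => ∏ b, y b ^ (r i b).val, fun k hk u => ?_⟩
  set H : (Fin (6 * L) → ℤˣ) → (Fin L → ℤˣ) := fun y i => ∏ b, y b ^ (r i b).val with hH
  -- Fourier expansion of the indicator of a fiber: expanding the product gives the characters of
  -- all subset sums of the code vectors.
  have hind : ∀ y, ∏ i, (1 + ((H y i * u i : ℤˣ) : ℤ)) = if H y = u then 2 ^ L else 0 := by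
    intro y
    split_ifs with h
    · rw [h]
      simp [Int.units_mul_self]
    · obtain ⟨i, hi⟩ := Function.ne_iff.1 h
      refine Finset.prod_eq_zero (Finset.mem_univ i) ?_
      rcases Int.units_eq_one_or (H y i) with h1 | h1 <;>
        rcases Int.units_eq_one_or (u i) with h2 | h2 <;> simp_all
  have hA : ∀ A : Finset (Fin L), A.Nonempty →
      ∑ y : Fin (6 * L) → ℤˣ, (∏ i ∈ A, ((H y i : ℤˣ) : ℤ)) * ∏ b, (y b : ℤ) ^ k b = 0 := by
    intro A hne
    have hw := hr (A.map Fin.valEmbedding) (fun i hi => by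
      obtain ⟨j, -, rfl⟩ := Finset.mem_map.1 hi
      exact Finset.mem_range.2 j.2) (hne.map)
    -- The character has at least L coordinates in its support and the monomial fewer than L
    -- variables, so some coordinate occurs in the character alone and has odd exponent.
    obtain ⟨b, hb, hkb⟩ : ∃ b, (∑ i ∈ A, r i) b ≠ 0 ∧ k b = 0 := by
      by_contra! hcon
      rw [Finset.sum_map] at hw
      have h1 : #{b | (∑ i ∈ A, r (Fin.valEmbedding i)) b ≠ 0} ≤
          ∑ b with (∑ i ∈ A, r (Fin.valEmbedding i)) b ≠ 0, k b := by
        rw [Finset.card_eq_sum_ones]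
        exact Finset.sum_le_sum fun b hb =>
          Nat.one_le_iff_ne_zero.2 (hcon b (Finset.mem_filter.1 hb).2)
      have h2 : ∑ b with (∑ i ∈ A, r (Fin.valEmbedding i)) b ≠ 0, k b ≤ ∑ b, k b :=
        Finset.sum_le_sum_of_subset (Finset.subset_univ _)
      omega
    have hodd : Odd (∑ i ∈ A, (r i b).val + k b) := by
      rw [hkb, add_zero, ← Nat.not_even_iff_odd, even_iff_two_dvd, ← ZMod.natCast_eq_zero_iff]
      simpa using hb
    rw [← sum_prod_pow_eq_zero (fun b => ∑ i ∈ A, (r i b).val + k b) hodd]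
    refine Finset.sum_congr rfl fun y _ => ?_
    simp only [hH, Units.coe_prod, Units.val_pow_eq_pow_val]
    rw [Finset.prod_comm, ← Finset.prod_mul_distrib]
    simp only [pow_add, Finset.prod_pow_eq_pow_sum]
  calc 2 ^ L * ∑ y with H y = u, ∏ b, (y b : ℤ) ^ k b
      = ∑ y, (∏ i, (1 + ((H y i * u i : ℤˣ) : ℤ))) * ∏ b, (y b : ℤ) ^ k b := by
        simp only [hind, Finset.mul_sum, Finset.sum_filter, ite_mul, zero_mul, mul_ite, mul_zero]
    _ = ∑ A : Finset (Fin L), (∏ i ∈ A, ((u i : ℤˣ) : ℤ)) *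
          ∑ y, (∏ i ∈ A, ((H y i : ℤˣ) : ℤ)) * ∏ b, (y b : ℤ) ^ k b := by
        simp only [Finset.prod_one_add, Finset.sum_mul, Finset.mul_sum, Finset.powerset_univ]
        rw [Finset.sum_comm]
        refine Finset.sum_congr rfl fun A _ => Finset.sum_congr rfl fun y _ => ?_
        simp only [Units.val_mul, Finset.prod_mul_distrib]
        ring
    _ = ∑ y : Fin (6 * L) → ℤˣ, ∏ b, (y b : ℤ) ^ k b := by
        rw [Finset.sum_eq_single ∅]
        · simp
        · intro A _ hne
          rw [hA A (Finset.nonempty_iff_ne_empty.2 hne), mul_zero]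
        · simp

/-! ### Substituting gates for the variables of a circuit. -/

/-- Renumbering the earlier nodes read by a gate. -/
def Gate.map {n s s' : ℕ} (f : Fin s ↪ Fin s') : Gate n s → Gate n s'
  | .input v => .input v
  | .not j => .not (f j)
  | .and J => .and (J.map f)
  | .or J => .or (J.map f)

theorem Gate.eval_map {n s s' : ℕ} (f : Fin s ↪ Fin s') (a : Gate n s) (x : Fin n → ℤˣ)
    (v : Fin s' → ℤˣ) : (a.map f).eval x v = a.eval x (fun j => v (f j)) := by
  cases a <;> simp [Gate.map, Gate.eval]

theorem Gate.depth_map {n s s' : ℕ} (f : Fin s ↪ Fin s') (a : Gate n s) (d : Fin s' → ℕ) :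
    (a.map f).depth d = a.depth (fun j => d (f j)) := by
  cases a <;> simp [Gate.map, Gate.depth, Finset.sup_map, Function.comp_def]

/-- The circuit that lists `t` input variables. -/
def Circuit.inputs {n : ℕ} : (t : ℕ) → (Fin t → Fin n) → Circuit n t
  | 0, _ => .nil
  | t + 1, f => .snoc (Circuit.inputs t fun i => f i.castSucc) (.input (f (Fin.last t)))

theorem Circuit.eval_inputs {n : ℕ} (t : ℕ) (f : Fin t → Fin n) (x : Fin n → ℤˣ) (i : Fin t) :
    (Circuit.inputs t f).eval x i = x (f i) := by
  induction t with
  | zero => exact i.elim0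
  | succ t ih =>
    refine Fin.lastCases ?_ (fun j => ?_) i
    · simp [Circuit.inputs, Circuit.eval, Gate.eval]
    · simp [Circuit.inputs, Circuit.eval, ih]

theorem Circuit.depth_inputs {n : ℕ} (t : ℕ) (f : Fin t → Fin n) (i : Fin t) :
    (Circuit.inputs t f).depth i = 0 := by
  induction t with
  | zero => exact i.elim0
  | succ t ih =>
    refine Fin.lastCases ?_ (fun j => ?_) i
    · simp [Circuit.inputs, Circuit.depth, Gate.depth]
    · simp [Circuit.inputs, Circuit.depth, ih]

theorem Circuit.isMonotone_inputs {n : ℕ} (t : ℕ) (f : Fin t → Fin n) :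
    (Circuit.inputs t f).IsMonotone := by
  induction t with
  | zero => trivial
  | succ t ih => exact ⟨ih _, by simp⟩

theorem Circuit.andAtBottom_inputs {n : ℕ} (t : ℕ) (f : Fin t → Fin n) :
    (Circuit.inputs t f).AndAtBottom := by
  induction t with
  | zero => trivial
  | succ t ih => exact ⟨ih _, trivial⟩

/-- The gate `a` of a circuit on `R` variables, placed after `s₀` further nodes, where the
variable `v` is replaced by the gate `sub v` on these nodes. -/
def Gate.subst {n s₀ R s : ℕ} (sub : Fin R → Gate n s₀) : Gate R s → Gate n (s₀ + s)
  | .input v => (sub v).map (Fin.castAddEmb s)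
  | .not j => .not (Fin.natAdd s₀ j)
  | .and J => .and (J.map (Fin.natAddEmb s₀))
  | .or J => .or (J.map (Fin.natAddEmb s₀))

/-- The circuit `c` on `R` variables placed on top of `c₀`, where the variable `v` is replaced
by the gate `sub v` that reads nodes of `c₀`. -/
def Circuit.subst {n s₀ R : ℕ} (c₀ : Circuit n s₀) (sub : Fin R → Gate n s₀) :
    {s : ℕ} → Circuit R s → Circuit n (s₀ + s)
  | _, .nil => c₀
  | _, .snoc c a => .snoc (c₀.subst sub c) (a.subst sub)

section Subst

variable {n s₀ R s : ℕ} (c₀ : Circuit n s₀) (sub : Fin R → Gate n s₀)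

theorem Circuit.eval_subst_castAdd (c : Circuit R s) (x : Fin n → ℤˣ) (i : Fin s₀) :
    (c₀.subst sub c).eval x (Fin.castAdd s i) = c₀.eval x i := by
  induction c with
  | nil => rfl
  | @snoc s c a ih =>
    rw [← ih]
    exact Fin.snoc_castSucc (α := fun _ => ℤˣ) _ _ (Fin.castAdd s i)

theorem Circuit.depth_subst_castAdd (c : Circuit R s) (i : Fin s₀) :
    (c₀.subst sub c).depth (Fin.castAdd s i) = c₀.depth i := by
  induction c with
  | nil => rfl
  | @snoc s c a ih =>
    rw [← ih]
    exact Fin.snoc_castSucc (α := fun _ => ℕ) _ _ (Fin.castAdd s i)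

theorem Circuit.isInput_subst_castAdd (c : Circuit R s) (i : Fin s₀) :
    (c₀.subst sub c).IsInput (Fin.castAdd s i) = c₀.IsInput i := by
  induction c with
  | nil => rfl
  | @snoc s c a ih =>
    rw [← ih]
    exact Fin.snoc_castSucc (α := fun _ => Prop) _ _ (Fin.castAdd s i)

theorem Circuit.eval_subst_natAdd (c : Circuit R s) (x : Fin n → ℤˣ) (i : Fin s) :
    (c₀.subst sub c).eval x (Fin.natAdd s₀ i) =
      c.eval (fun v => (sub v).eval x (c₀.eval x)) i := by
  induction c with
  | nil => exact i.elim0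
  | @snoc s c a ih =>
    refine Fin.lastCases ?_ (fun j => ?_) i
    · refine (Fin.snoc_last (α := fun _ => ℤˣ) _ _).trans
        (Eq.trans ?_ (Fin.snoc_last (α := fun _ => ℤˣ) _ _).symm)
      cases a with
      | input v =>
        rw [Gate.subst, Gate.eval_map]
        exact congrArg (fun w => (sub v).eval x w)
          (funext fun j => c₀.eval_subst_castAdd sub c x j)
      | not j => exact congrArg Neg.neg (ih j)
      | and J =>
        exact (Gate.eval_map (Fin.natAddEmb s₀) (.and J : Gate n s) x _).trans
          (congrArg (fun w => (Gate.and J : Gate n s).eval x w) (funext ih))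
      | or J =>
        exact (Gate.eval_map (Fin.natAddEmb s₀) (.or J : Gate n s) x _).trans
          (congrArg (fun w => (Gate.or J : Gate n s).eval x w) (funext ih))
    · refine (Fin.snoc_castSucc (α := fun _ => ℤˣ) _ _ (Fin.natAdd s₀ j)).trans
        (Eq.trans (ih j) (Fin.snoc_castSucc (α := fun _ => ℤˣ) _ _ _).symm)

theorem Circuit.depth_subst_natAdd (c : Circuit R s) {d : ℕ}
    (hd : ∀ v, (sub v).depth c₀.depth ≤ d) (i : Fin s) :
    (c₀.subst sub c).depth (Fin.natAdd s₀ i) ≤ c.depth i + d := by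
  induction c with
  | nil => exact i.elim0
  | @snoc s c a ih =>
    refine Fin.lastCases ?_ (fun j => ?_) i
    · refine ((Fin.snoc_last (α := fun _ => ℕ) _ _).le.trans ?_).trans
        (Nat.add_le_add_right (Fin.snoc_last (α := fun _ => ℕ) _ _).ge d)
      have hsup : ∀ J : Finset (Fin s),
          (J.map (Fin.natAddEmb s₀)).sup (c₀.subst sub c).depth ≤ J.sup c.depth + d := by
        intro J
        rw [Finset.sup_map]
        exact Finset.sup_le fun j hj =>
          (ih j).trans (Nat.add_le_add_right (Finset.le_sup (f := c.depth) hj) d)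
      cases a with
      | input v =>
        rw [Gate.subst, Gate.depth_map]
        refine Eq.trans_le ?_ ((hd v).trans (Nat.le_add_left _ _))
        exact congrArg (fun w => (sub v).depth w)
          (funext fun j => c₀.depth_subst_castAdd sub c j)
      | not j => exact ih j
      | and J => have := hsup J; simp only [Gate.subst, Gate.depth]; omega
      | or J => have := hsup J; simp only [Gate.subst, Gate.depth]; omega
    · exact ((Fin.snoc_castSucc (α := fun _ => ℕ) _ _ (Fin.natAdd s₀ j)).le.trans (ih j)).trans
        (Nat.add_le_add_right (Fin.snoc_castSucc (α := fun _ => ℕ) _ _ j).ge d)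

theorem Circuit.isMonotone_subst (c : Circuit R s) (h₀ : c₀.IsMonotone)
    (hsub : ∀ v j, sub v ≠ .not j) (hc : c.IsMonotone) : (c₀.subst sub c).IsMonotone := by
  induction c with
  | nil => exact h₀
  | @snoc s c a ih =>
    refine ⟨ih hc.1, fun j => ?_⟩
    cases a with
    | input v =>
      have := hsub v
      cases h : sub v <;> simp_all [Gate.subst, Gate.map]
    | not j => exact absurd rfl (hc.2 j)
    | and J => simp [Gate.subst]
    | or J => simp [Gate.subst]

theorem Circuit.not_isInput_subst_natAdd (c : Circuit R s) (hsub : ∀ v w, sub v ≠ .input w)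
    (i : Fin s) : ¬ (c₀.subst sub c).IsInput (Fin.natAdd s₀ i) := by
  induction c with
  | nil => exact i.elim0
  | @snoc s c a ih =>
    refine Fin.lastCases ?_ (fun j => ?_) i
    · intro h
      have h' : ∃ w, a.subst sub = .input w :=
        (Fin.snoc_last (α := fun _ => Prop) (∃ w, a.subst sub = .input w)
          (c₀.subst sub c).IsInput) ▸ h
      obtain ⟨w, hw⟩ := h'
      cases a with
      | input v =>
        have := hsub v
        cases h : sub v <;> simp_all [Gate.subst, Gate.map]
      | not j => simp [Gate.subst] at hw
      | and J => simp [Gate.subst] at hw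
      | or J => simp [Gate.subst] at hw
    · intro h
      exact ih j ((Fin.snoc_castSucc (α := fun _ => Prop) (∃ w, a.subst sub = .input w)
          (c₀.subst sub c).IsInput (Fin.natAdd s₀ j)) ▸ h)

/-- The alternatives in `hsub` serve the two layers added below F: ANDs of input variables, then ORs
of those ANDs. In either case no variable of `c` becomes an input node, so the gates of `c` read
none. -/
theorem Circuit.andAtBottom_subst (c : Circuit R s) (h₀ : c₀.AndAtBottom)
    (hsub : ∀ v, (∃ J, sub v = .and J) ∨ ∃ J, sub v = .or J ∧ ∀ j ∈ J, ¬ c₀.IsInput j)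
    (hc : c.IsMonotone) : (c₀.subst sub c).AndAtBottom := by
  have hin : ∀ v w, sub v ≠ .input w := by
    intro v w h
    rcases hsub v with ⟨J, hJ⟩ | ⟨J, hJ, -⟩ <;> simp [hJ] at h
  induction c with
  | nil => exact h₀
  | @snoc s c a ih =>
    refine ⟨ih hc.1, ?_⟩
    cases a with
    | input v =>
      rcases hsub v with ⟨J, hJ⟩ | ⟨J, hJ, hJ'⟩
      · simp [Gate.subst, hJ, Gate.map]
      · simp only [Gate.subst, hJ, Gate.map, Finset.mem_map, forall_exists_index, and_imp,
          forall_apply_eq_imp_iff₂]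
        exact fun j hj h => hJ' j hj (c₀.isInput_subst_castAdd sub c j ▸ h)
    | not j => exact absurd rfl (hc.2 j)
    | and J => simp [Gate.subst]
    | or J =>
      simp only [Gate.subst, Finset.mem_map, forall_exists_index, and_imp,
          forall_apply_eq_imp_iff₂]
      exact fun j _ => c₀.not_isInput_subst_natAdd sub c hin j

end Subst

/-! ### The lifted function, its circuits and its DNFs. -/

/-- The variables asserting that the `j`-th block, whose bits are given by pairs of opposite
literals, equals `u`. -/
def minterm {n N m : ℕ} (e : Fin n ≃ Fin N × Fin m × Bool) (j : Fin N) (u : Fin m → ℤˣ) :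
    Finset (Fin n) :=
  Finset.univ.image fun b => e.symm (j, b, decide (u b = 1))

/-- The function `F` applied to the `R` disjunctions, over all blocks, of the minterms
belonging to `U 1, …, U R`. -/
def blockLift {n N m R : ℕ} (e : Fin n ≃ Fin N × Fin m × Bool)
    (U : Fin R → Finset (Fin m → ℤˣ)) (F : (Fin R → ℤˣ) → ℤˣ) (Y : Fin n → ℤˣ) : ℤˣ :=
  F fun i => if ∃ j, ∃ u ∈ U i, ∀ v ∈ minterm e j u, Y v = -1 then -1 else 1

/-- One AND gate per block and block value computes all minterms. The ORs of minterms take the place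
of the input nodes of `c`, so they cost depth but no further nodes. -/
theorem exists_circuit_blockLift {n N m R : ℕ} (e : Fin n ≃ Fin N × Fin m × Bool)
    (U : Fin R → Finset (Fin m → ℤˣ)) (F : (Fin R → ℤˣ) → ℤˣ) {s : ℕ} (c : Circuit R s)
    (o : Fin s) (hc : c.Computes o F) :
    ∃ (c' : Circuit n (n + N * 2 ^ m + s)) (o' : Fin (n + N * 2 ^ m + s)),
      c'.Computes o' (blockLift e U F) ∧ c'.depth o' ≤ c.depth o + 2 ∧
        (c.IsMonotone → c'.IsMonotone ∧ c'.AndAtBottom) := by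
  have hcard : Fintype.card (Fin N × (Fin m → ℤˣ)) = N * 2 ^ m := by
    simp [Fintype.card_units_int]
  let ν : Fin (N * 2 ^ m) ≃ Fin N × (Fin m → ℤˣ) := (Fintype.equivFinOfCardEq hcard).symm
  let c₁ : Circuit n n := Circuit.inputs n id
  let sub₁ : Fin (N * 2 ^ m) → Gate n n := fun k => .and (minterm e (ν k).1 (ν k).2)
  let c₂ : Circuit n (n + N * 2 ^ m) := c₁.subst sub₁ (Circuit.inputs (N * 2 ^ m) id)
  let sub₂ : Fin R → Gate n (n + N * 2 ^ m) := fun i =>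
    .or ((Finset.univ.filter fun k => (ν k).2 ∈ U i).map (Fin.natAddEmb n))
  refine ⟨c₂.subst sub₂ c, Fin.natAdd _ o, fun Y => ?_, ?_, fun hm => ⟨?_, ?_⟩⟩
  · rw [Circuit.eval_subst_natAdd, hc, blockLift]
    congr 1
    funext i
    have h1 : ∀ k, c₂.eval Y (Fin.natAdd n k) =
        if ∀ v ∈ minterm e (ν k).1 (ν k).2, Y v = -1 then -1 else 1 := fun k => by
      simp only [c₂, sub₁, c₁, Circuit.eval_subst_natAdd, Circuit.eval_inputs, Gate.eval, id]
    have h2 : ∀ P : Prop, ∀ _ : Decidable P, (if P then (-1 : ℤˣ) else 1) = -1 ↔ P :=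
      fun P _ => by split_ifs with h <;> simp [h]
    simp only [sub₂, Gate.eval, Finset.mem_map, exists_exists_and_eq_and, Fin.natAddEmb_apply,
      h1, h2, Finset.mem_filter, Finset.mem_univ, true_and]
    refine if_congr ⟨?_, ?_⟩ rfl rfl
    · rintro ⟨k, hk, hY⟩
      exact ⟨_, _, hk, hY⟩
    · rintro ⟨j, u, hu, hY⟩
      exact ⟨ν.symm (j, u), by simpa using hu, by simpa using hY⟩
  · refine Circuit.depth_subst_natAdd _ _ _ (fun i => ?_) _
    refine Nat.succ_le_succ (Finset.sup_le fun k hk => ?_)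
    obtain ⟨k, -, rfl⟩ := Finset.mem_map.1 hk
    refine (Circuit.depth_subst_natAdd c₁ sub₁ _ (d := 1) (fun k => ?_) k).trans ?_
    · exact Nat.succ_le_succ (Finset.sup_le fun v _ => (Circuit.depth_inputs _ _ v).le)
    · rw [Circuit.depth_inputs]
  · exact Circuit.isMonotone_subst _ _ _ (Circuit.isMonotone_subst _ _ _
      (Circuit.isMonotone_inputs _ _) (by simp [sub₁]) (Circuit.isMonotone_inputs _ _))
      (by simp [sub₂]) hm
  · refine Circuit.andAtBottom_subst _ _ _ (Circuit.andAtBottom_subst _ _ _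
      (Circuit.andAtBottom_inputs _ _) (fun k => Or.inl ⟨_, rfl⟩)
      (Circuit.isMonotone_inputs _ _)) (fun i => Or.inr ⟨_, rfl, fun k hk => ?_⟩) hm
    obtain ⟨k, -, rfl⟩ := Finset.mem_map.1 hk
    exact Circuit.not_isInput_subst_natAdd _ _ _ (by simp [sub₁]) k

/-- Distributivity: a new term chooses, for each variable of an old term, one minterm from its
disjunction, and a minterm has at most `m` variables. -/
theorem exists_monotoneDNF_blockLift {n N m R : ℕ} (hN : 1 ≤ N)
    (e : Fin n ≃ Fin N × Fin m × Bool) (U : Fin R → Finset (Fin m → ℤˣ))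
    (F : (Fin R → ℤˣ) → ℤˣ) (T : MonotoneDNF R) (hT : ∀ x, T.eval x = F x) :
    ∃ T' : MonotoneDNF n, (∀ y, T'.eval y = blockLift e U F y) ∧ T'.width ≤ T.width * m := by
  classical
  let P : Finset (Fin R) → (Fin R → Fin N × (Fin m → ℤˣ)) → Finset (Fin n) := fun t ψ =>
    t.biUnion fun i => minterm e (ψ i).1 (ψ i).2
  refine ⟨T.biUnion fun t => (Finset.univ.filter fun ψ : Fin R → Fin N × (Fin m → ℤˣ) =>
    ∀ i ∈ t, (ψ i).2 ∈ U i).image (P t), fun Y => ?_, Finset.sup_le fun q hq => ?_⟩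
  · rw [blockLift, ← hT, MonotoneDNF.eval, MonotoneDNF.eval]
    have h2 : ∀ P : Prop, ∀ _ : Decidable P, (if P then (-1 : ℤˣ) else 1) = -1 ↔ P :=
      fun P _ => by split_ifs with h <;> simp [h]
    simp only [h2]
    refine if_congr ⟨?_, ?_⟩ rfl rfl
    · rintro ⟨q, hq, hY⟩
      obtain ⟨t, ht, hq⟩ := Finset.mem_biUnion.1 hq
      obtain ⟨ψ, hψ, rfl⟩ := Finset.mem_image.1 hq
      exact ⟨t, ht, fun i hi => ⟨(ψ i).1, (ψ i).2, (Finset.mem_filter.1 hψ).2 i hi,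
        fun v hv => hY v (Finset.mem_biUnion.2 ⟨i, hi, hv⟩)⟩⟩
    · rintro ⟨t, ht, h⟩
      -- The choice functions need a default value outside `t`.
      have : Nonempty (Fin N) := ⟨⟨0, hN⟩⟩
      choose! j u hu hY using h
      refine ⟨P t fun i => (j i, u i), Finset.mem_biUnion.2 ⟨t, ht, Finset.mem_image.2
        ⟨fun i => (j i, u i), by simpa using hu, rfl⟩⟩, fun v hv => ?_⟩
      obtain ⟨i, hi, hv⟩ := Finset.mem_biUnion.1 hv
      exact hY i hi v hv
  · obtain ⟨t, ht, hq⟩ := Finset.mem_biUnion.1 hq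
    obtain ⟨ψ, -, rfl⟩ := Finset.mem_image.1 hq
    refine (Finset.card_biUnion_le_card_mul _ _ m fun i _ => ?_).trans
      (Nat.mul_le_mul_right _ (Finset.le_sup (f := Finset.card) ht))
    exact Finset.card_image_le.trans (by simp)

/-! ### Polynomial functions on a domain and symmetrization. -/

/-- `f` agrees on `D` with a real polynomial of degree at most `d`. -/
def IsPolyOn {κ : Type} (D : Set (κ → ℤˣ)) (d : ℕ) (f : (κ → ℤˣ) → ℝ) : Prop :=
  ∃ q : MvPolynomial κ ℝ, q.totalDegree ≤ d ∧
    ∀ x ∈ D, MvPolynomial.eval (fun i => ((x i : ℤ) : ℝ)) q = f x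

namespace IsPolyOn

variable {κ : Type} {D : Set (κ → ℤˣ)} {d d' : ℕ} {f f' : (κ → ℤˣ) → ℝ}

theorem congr (h : IsPolyOn D d f) (hf : ∀ x ∈ D, f x = f' x) : IsPolyOn D d f' := by
  obtain ⟨q, hq, he⟩ := h
  exact ⟨q, hq, fun x hx => (he x hx).trans (hf x hx)⟩

theorem mono (h : IsPolyOn D d f) (hd : d ≤ d') : IsPolyOn D d' f := by
  obtain ⟨q, hq, he⟩ := h
  exact ⟨q, hq.trans hd, he⟩

theorem const (c : ℝ) : IsPolyOn D d (fun _ => c) :=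
  ⟨MvPolynomial.C c, by simp, by simp⟩

theorem coord (i : κ) : IsPolyOn D 1 (fun x => ((x i : ℤ) : ℝ)) :=
  ⟨MvPolynomial.X i, by simp, by simp⟩

theorem add (h : IsPolyOn D d f) (h' : IsPolyOn D d f') :
    IsPolyOn D d (fun x => f x + f' x) := by
  obtain ⟨q, hq, he⟩ := h
  obtain ⟨q', hq', he'⟩ := h'
  exact ⟨q + q', (MvPolynomial.totalDegree_add _ _).trans (max_le hq hq'),
    fun x hx => by rw [map_add, he x hx, he' x hx]⟩

theorem mul (h : IsPolyOn D d f) (h' : IsPolyOn D d' f') :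
    IsPolyOn D (d + d') (fun x => f x * f' x) := by
  obtain ⟨q, hq, he⟩ := h
  obtain ⟨q', hq', he'⟩ := h'
  exact ⟨q * q', (MvPolynomial.totalDegree_mul _ _).trans (add_le_add hq hq'),
    fun x hx => by rw [map_mul, he x hx, he' x hx]⟩

theorem const_mul (h : IsPolyOn D d f) (c : ℝ) : IsPolyOn D d (fun x => c * f x) :=
  ((const (d := 0) c).mul h).mono (by simp)

theorem sum {α : Type*} (s : Finset α) {F : α → (κ → ℤˣ) → ℝ}
    (h : ∀ a ∈ s, IsPolyOn D d (F a)) : IsPolyOn D d (fun x => ∑ a ∈ s, F a x) := by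
  classical
  induction s using Finset.induction_on with
  | empty => simpa using const (D := D) (d := d) 0
  | insert a s ha ih =>
    simp only [Finset.sum_insert ha]
    exact (h a (Finset.mem_insert_self _ _)).add
      (ih fun b hb => h b (Finset.mem_insert_of_mem hb))

end IsPolyOn

/-- Symmetrization: if the numbers of occurrences of the values of `v x` are affine functions
of `x`, then averaging a product over `J` against all permutations yields a polynomial in `x`
of degree at most `#J`. -/
theorem isPolyOn_sum_perm {κ : Type} {D : Set (κ → ℤˣ)} {N : ℕ} {β : Type} [Fintype β]
    [DecidableEq β] (v : (κ → ℤˣ) → Fin N → β)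
    (hv : ∀ o, IsPolyOn D 1 fun x => (#{j | v x j = o} : ℝ)) (J : Finset (Fin N)) :
    ∀ φ : Fin N → β → ℝ, IsPolyOn D #J fun x =>
      ∑ σ : Equiv.Perm (Fin N), ∏ j ∈ J, φ j (v x (σ j)) := by
  induction J using Finset.induction_on with
  | empty => intro φ; simpa using IsPolyOn.const (D := D) (d := 0) _
  | insert a J ha ih =>
    intro φ
    rw [Finset.card_insert_of_notMem ha]
    -- Precomposing with the transposition of `a` and `t` fixes `J`, so the new factor may be read
    -- at any `t` outside `J`. Hence `#Jᶜ` times the desired sum is the sum over all `t`, in which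
    -- the new factor splits off as an affine function, minus the sum over `t ∈ J`, where `hupd`
    -- absorbs it into an old factor.
    have hswap : ∀ x, ∀ t ∉ J,
        ∑ σ : Equiv.Perm (Fin N), (∏ j ∈ J, φ j (v x (σ j))) * φ a (v x (σ t)) =
          ∑ σ : Equiv.Perm (Fin N), (∏ j ∈ J, φ j (v x (σ j))) * φ a (v x (σ a)) := by
      intro x t ht
      refine Fintype.sum_equiv (Equiv.mulRight (Equiv.swap a t)) _ _ fun σ => ?_
      simp only [Equiv.coe_mulRight, Equiv.Perm.mul_apply, Equiv.swap_apply_left]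
      congr 1
      refine Finset.prod_congr rfl fun j hj => ?_
      rw [Equiv.swap_apply_of_ne_of_ne (ne_of_mem_of_not_mem hj ha) (ne_of_mem_of_not_mem hj ht)]
    have hupd : ∀ x (σ : Equiv.Perm (Fin N)), ∀ t ∈ J,
        (∏ j ∈ J, φ j (v x (σ j))) * φ a (v x (σ t)) =
          ∏ j ∈ J, (if j = t then fun o => φ j o * φ a o else φ j) (v x (σ j)) := by
      intro x σ t ht
      have h : ∀ j ∈ J, (if j = t then fun o => φ j o * φ a o else φ j) (v x (σ j)) =
          φ j (v x (σ j)) * if t = j then φ a (v x (σ j)) else 1 := fun j _ => by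
        by_cases hjt : j = t
        · simp [hjt]
        · simp [hjt, Ne.symm hjt]
      rw [Finset.prod_congr rfl h, Finset.prod_mul_distrib, Finset.prod_ite_eq, if_pos ht]
    have hlin : IsPolyOn D 1 fun x => ∑ t, φ a (v x t) := by
      refine (IsPolyOn.sum Finset.univ fun o _ => (hv o).const_mul (φ a o)).congr fun x _ => ?_
      rw [← Finset.sum_fiberwise (s := Finset.univ) (g := v x)]
      refine Finset.sum_congr rfl fun o _ => ?_
      rw [Finset.sum_congr rfl (g := fun _ => φ a o)
        (fun j hj => by rw [(Finset.mem_filter.1 hj).2])]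
      simp [mul_comm]
    have hpos : (0 : ℝ) < #(Jᶜ) := by
      exact_mod_cast Finset.card_pos.2 ⟨a, by simpa using ha⟩
    refine ((((ih φ).mul hlin).add ((IsPolyOn.sum J fun t _ =>
      ih fun j => if j = t then fun o => φ j o * φ a o else φ j).const_mul (-1)|>.mono
        (Nat.le_succ _))).const_mul (#(Jᶜ) : ℝ)⁻¹).congr fun x _ => ?_
    rw [inv_mul_eq_iff_eq_mul₀ hpos.ne']
    have h1 : (∑ σ : Equiv.Perm (Fin N), ∏ j ∈ J, φ j (v x (σ j))) * ∑ t, φ a (v x t) =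
        ∑ t, ∑ σ : Equiv.Perm (Fin N), (∏ j ∈ J, φ j (v x (σ j))) * φ a (v x (σ t)) := by
      rw [Finset.sum_comm, Finset.sum_mul]
      refine Finset.sum_congr rfl fun σ _ => ?_
      rw [← Finset.mul_sum, Equiv.sum_comp σ fun t => φ a (v x t)]
    rw [h1, ← Finset.sum_add_sum_compl J,
      Finset.sum_congr rfl fun t ht => hswap x t (Finset.mem_compl.1 ht),
      Finset.sum_congr rfl fun t ht => Finset.sum_congr rfl fun σ _ => hupd x σ t ht]
    simp only [Finset.sum_const, nsmul_eq_mul, Finset.prod_insert ha]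
    simp only [mul_comm (φ a _)]
    ring

/-! ### Slots and their encodings. -/

/-- A point of low weight is the sum of `N` indicator vectors, some of them zero. -/
theorem exists_assignment {N R : ℕ} (x : Fin R × Fin N → ℤˣ) (hx : hammingWeight x ≤ N) :
    ∃ v : Fin N → Option (Fin R), ∀ i, #{j | v j = some i} = #{j | x (i, j) = -1} := by
  obtain ⟨f⟩ : Nonempty ({t // x t = -1} ↪ Fin N) := by
    refine Function.Embedding.nonempty_of_card_le ?_
    rw [Fintype.card_subtype, Fintype.card_fin]
    exact hx
  have hf := f.injective.isPartialInv
  refine ⟨fun j => (Function.partialInv f j).map fun t => t.1.1, fun i => ?_⟩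
  symm
  refine Finset.card_bij (fun j hj => f ⟨(i, j), (Finset.mem_filter.1 hj).2⟩) (fun j hj => ?_)
    (fun j _ k _ h => ?_) (fun k hk => ?_)
  · simp only [Finset.mem_filter, Finset.mem_univ, true_and, Option.map_eq_some_iff]
    exact ⟨_, (hf _ _).2 rfl, rfl⟩
  · simpa using f.injective h
  · simp only [Finset.mem_filter, Finset.mem_univ, true_and, Option.map_eq_some_iff] at hk
    obtain ⟨⟨⟨i', j⟩, ht⟩, h1, rfl⟩ := hk
    exact ⟨j, by simpa using ht, (hf _ _).1 h1⟩

/-- The input whose pairs of literals are given by the blocks `y 1, …, y N`. -/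
def literalInput {n N m : ℕ} (e : Fin n ≃ Fin N × Fin m × Bool) (y : Fin N → Fin m → ℤˣ)
    (i : Fin n) : ℤˣ :=
  (if (e i).2.2 then -1 else 1) * y (e i).1 (e i).2.1

/-- The flag `true` marks the negated copy of a bit, which is TRUE exactly when the bit is `1`. -/
theorem minterm_literalInput {n N m : ℕ} (e : Fin n ≃ Fin N × Fin m × Bool)
    (y : Fin N → Fin m → ℤˣ) (j : Fin N) (u : Fin m → ℤˣ) :
    (∀ i ∈ minterm e j u, literalInput e y i = -1) ↔ y j = u := by
  simp only [minterm, literalInput, Finset.mem_image, Finset.mem_univ, true_and,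
    forall_exists_index, forall_apply_eq_imp_iff, Equiv.apply_symm_apply, decide_eq_true_eq,
    funext_iff]
  refine forall_congr' fun b => ?_
  rcases Int.units_eq_one_or (y j b) with h1 | h1 <;>
    rcases Int.units_eq_one_or (u b) with h2 | h2 <;> simp [h1, h2]

/-- Separates the blocks, so that sums over their encodings can be taken independently; opposite
literals differ only by a sign, and their exponents add. -/
theorem prod_literalInput_pow {n N m : ℕ} (e : Fin n ≃ Fin N × Fin m × Bool)
    (y : Fin N → Fin m → ℤˣ) (k : Fin n → ℕ) :
    ∏ i, ((literalInput e y i : ℤ) : ℝ) ^ k i =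
      ∏ j, ((∏ b, (-1) ^ k (e.symm (j, b, true))) * ∏ b, ((y j b : ℤ) : ℝ) ^
        (k (e.symm (j, b, true)) + k (e.symm (j, b, false)))) := by
  rw [← Equiv.prod_comp e.symm, Fintype.prod_prod_type]
  refine Finset.prod_congr rfl fun j _ => ?_
  rw [Fintype.prod_prod_type, ← Finset.prod_mul_distrib]
  refine Finset.prod_congr rfl fun b _ => ?_
  rw [Fintype.prod_bool]
  simp only [literalInput, Equiv.apply_symm_apply]
  simp only [if_true, Bool.false_eq_true, if_false, neg_mul, one_mul, Units.val_neg, Int.cast_neg]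
  rw [neg_pow ((y j b : ℤ) : ℝ), pow_add, mul_assoc]

/-- By disjointness a block decodes to `some i` only if its slot holds `i`; equality of counts makes
this happen for some slot exactly when the `i`-th block of `x` contains a `-1`. -/
theorem blockLift_literalInput {N R n m : ℕ} (e : Fin n ≃ Fin N × Fin m × Bool)
    (V : Option (Fin R) → Finset (Fin m → ℤˣ))
    (hdisj : ∀ o o' y, y ∈ V o → y ∈ V o' → o = o') (F : (Fin R → ℤˣ) → ℤˣ)
    (x : Fin R × Fin N → ℤˣ) (w : Fin N → Option (Fin R))
    (hw : ∀ i, #{j | w j = some i} = #{j | x (i, j) = -1})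
    (y : Fin N → Fin m → ℤˣ) (hy : ∀ j, y j ∈ V (w j)) :
    blockLift e (fun i => V (some i)) F (literalInput e y) =
      F fun i => orFun N fun j => x (i, j) := by
  rw [blockLift]
  congr 1
  funext i
  simp only [minterm_literalInput, orFun]
  refine if_congr ?_ rfl rfl
  have h1 : (∃ j, x (i, j) = -1) ↔ ∃ j, w j = some i := by
    have h := hw i
    rw [Finset.card_filter, Finset.card_filter] at h
    have h0 : (∀ j, w j ≠ some i) ↔ ∀ j, x (i, j) ≠ -1 := by
      simpa [Finset.sum_eq_zero_iff] using (congrArg (· = 0) h).to_iff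
    simpa using (not_congr h0).symm
  rw [h1]
  constructor
  · rintro ⟨j, u, hu, rfl⟩
    exact ⟨j, hdisj _ _ _ (hy j) hu⟩
  · rintro ⟨j, hj⟩
    exact ⟨j, y j, hj ▸ hy j, rfl⟩

/-- A block count is the sum of (1 - x)/2 over the block, and the padding count is `N` minus all the
others. -/
theorem isPolyOn_card_filter {N R : ℕ}
    (v : (Fin R × Fin N → ℤˣ) → Fin N → Option (Fin R))
    (hv : ∀ x ∈ lowWeight N R, ∀ i, #{j | v x j = some i} = #{j | x (i, j) = -1})
    (o : Option (Fin R)) :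
    IsPolyOn (lowWeight N R) 1 fun x => (#{j | v x j = o} : ℝ) := by
  have hsome : ∀ i, IsPolyOn (lowWeight N R) 1 fun x => (#{j | v x j = some i} : ℝ) := by
    intro i
    refine (IsPolyOn.sum Finset.univ fun j _ => (IsPolyOn.const (1 / 2 : ℝ)).add
      ((IsPolyOn.coord (i, j)).const_mul (-1 / 2))).congr fun x hx => ?_
    rw [hv x hx, Finset.card_filter, Nat.cast_sum]
    refine Finset.sum_congr rfl fun j _ => ?_
    rcases Int.units_eq_one_or (x (i, j)) with h | h <;> rw [h] <;> norm_num
  cases o with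
  | some i => exact hsome i
  | none =>
    refine ((IsPolyOn.const (N : ℝ)).add
      ((IsPolyOn.sum Finset.univ fun i _ => hsome i).const_mul (-1))).congr fun x _ => ?_
    have h := Finset.card_eq_sum_card_fiberwise (s := (univ : Finset (Fin N)))
      (t := (univ : Finset (Option (Fin R)))) (f := v x) (by simp)
    rw [Fintype.sum_option, Finset.card_univ, Fintype.card_fin] at h
    have h' : (N : ℝ) = #{j | v x j = none} + ∑ i, (#{j | v x j = some i} : ℝ) := by
      exact_mod_cast h
    rw [h']
    ring

/-! ### Averaging an approximating polynomial. -/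

theorem isPolyOn_symmetrization {N R n m L : ℕ} (hL : 1 ≤ L)
    (e : Fin n ≃ Fin N × Fin m × Bool) (V : Option (Fin R) → Finset (Fin m → ℤˣ))
    (hbal : ∀ k : Fin m → ℕ, ∑ b, k b < L → ∀ o o',
      ∑ y ∈ V o, ∏ b, (y b : ℤ) ^ k b = ∑ y ∈ V o', ∏ b, (y b : ℤ) ^ k b)
    (v : (Fin R × Fin N → ℤˣ) → Fin N → Option (Fin R))
    (hv : ∀ x ∈ lowWeight N R, ∀ i, #{j | v x j = some i} = #{j | x (i, j) = -1})
    (p : MvPolynomial (Fin n) ℝ) :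
    IsPolyOn (lowWeight N R) (p.totalDegree / L) fun x =>
      ∑ σ : Equiv.Perm (Fin N), ∑ y ∈ Fintype.piFinset fun j => V (v x (σ j)),
        MvPolynomial.eval (fun i => ((literalInput e y i : ℤ) : ℝ)) p := by
  let a : (Fin n →₀ ℕ) → Fin N → Fin m → ℕ := fun k j b =>
    k (e.symm (j, b, true)) + k (e.symm (j, b, false))
  let φ : (Fin n →₀ ℕ) → Fin N → Option (Fin R) → ℝ := fun k j o =>
    ∑ y ∈ V o, ((∏ b, (-1) ^ k (e.symm (j, b, true))) * ∏ b, ((y b : ℤ) : ℝ) ^ a k j b)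
  have hterm : ∀ k ∈ p.support, IsPolyOn (lowWeight N R) (p.totalDegree / L) fun x =>
      ∑ σ : Equiv.Perm (Fin N), ∏ j, φ k j (v x (σ j)) := by
    intro k hk
    -- The slots in which the monomial has degree at least `L`; only these depend on the contents.
    let J : Finset (Fin N) := {j | L ≤ ∑ b, a k j b}
    have hJ : #J ≤ p.totalDegree / L := by
      rw [Nat.le_div_iff_mul_le hL]
      calc #J * L ≤ ∑ j ∈ J, ∑ b, a k j b := by
            rw [← smul_eq_mul]
            exact Finset.card_nsmul_le_sum _ _ _ fun j hj => (Finset.mem_filter.1 hj).2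
        _ ≤ ∑ j, ∑ b, a k j b := Finset.sum_le_sum_of_subset (Finset.subset_univ _)
        _ = ∑ i, k i := by
            rw [← Equiv.sum_comp e.symm, Fintype.sum_prod_type]
            refine Finset.sum_congr rfl fun j _ => ?_
            rw [Fintype.sum_prod_type]
            simp only [Fintype.sum_bool, a]
        _ ≤ p.totalDegree := by
            rw [← Finsupp.sum_fintype k (fun _ c => c) (fun _ => rfl)]
            exact MvPolynomial.le_totalDegree hk
    -- Outside `J` balance allows the contents of a slot to be replaced by `none`, which leaves a
    -- constant factor.
    refine (((isPolyOn_sum_perm v (isPolyOn_card_filter v hv) J (φ k)).mono hJ).const_mul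
      (∏ j ∈ Jᶜ, φ k j none)).congr fun x _ => ?_
    rw [Finset.mul_sum]
    refine Finset.sum_congr rfl fun σ _ => ?_
    rw [← Finset.prod_compl_mul_prod J]
    congr 1
    refine Finset.prod_congr rfl fun j hj => ?_
    have hj' : ∑ b, a k j b < L := by simpa [J] using hj
    have h := hbal (a k j) hj' none (v x (σ j))
    simp only [φ, ← Finset.mul_sum]
    congr 1
    exact_mod_cast h
  refine (IsPolyOn.sum p.support fun k hk => (hterm k hk).const_mul (p.coeff k)).congr
    fun x _ => ?_
  simp only [MvPolynomial.eval_eq', prod_literalInput_pow]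
  simp only [Finset.mul_sum]
  rw [Finset.sum_comm]
  refine Finset.sum_congr rfl fun σ _ => ?_
  rw [Finset.sum_comm]
  refine Finset.sum_congr rfl fun k _ => ?_
  rw [← Finset.mul_sum]
  exact congrArg _ (Finset.prod_univ_sum _ _)

/-- A polynomial that approximates the lifted function yields one that approximates the
block composition on inputs of low weight, with its degree divided by `L`. -/
theorem exists_approx_promiseComp {N R n m L : ℕ} (hL : 1 ≤ L)
    (e : Fin n ≃ Fin N × Fin m × Bool) (V : Option (Fin R) → Finset (Fin m → ℤˣ))
    (hdisj : ∀ o o' y, y ∈ V o → y ∈ V o' → o = o') (hne : ∀ o, (V o).Nonempty)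
    (hbal : ∀ k : Fin m → ℕ, ∑ b, k b < L → ∀ o o',
      ∑ y ∈ V o, ∏ b, (y b : ℤ) ^ k b = ∑ y ∈ V o', ∏ b, (y b : ℤ) ^ k b)
    (F : (Fin R → ℤˣ) → ℤˣ) (ε : ℝ) (p : MvPolynomial (Fin n) ℝ)
    (hp : ∀ Y : Fin n → ℤˣ, |MvPolynomial.eval (fun i => ((Y i : ℤ) : ℝ)) p -
      ((blockLift e (fun i => V (some i)) F Y : ℤ) : ℝ)| ≤ ε) :
    ∃ q : MvPolynomial (Fin R × Fin N) ℝ, q.totalDegree * L ≤ p.totalDegree ∧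
      ∀ x : lowWeight N R, |MvPolynomial.eval (fun i => ((x.1 i : ℤ) : ℝ)) q -
        ((promiseComp N R F x : ℤ) : ℝ)| ≤ ε := by
  have hex : ∀ x : Fin R × Fin N → ℤˣ, ∃ w : Fin N → Option (Fin R), x ∈ lowWeight N R →
      ∀ i, #{j | w j = some i} = #{j | x (i, j) = -1} := fun x => by
    by_cases hx : x ∈ lowWeight N R
    · obtain ⟨w, hw⟩ := exists_assignment x hx
      exact ⟨w, fun _ => hw⟩
    · exact ⟨fun _ => none, fun h => absurd h hx⟩
  choose v hv using hex
  have hcard : ∀ o, #(V o) = #(V none) := fun o => by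
    have h := hbal 0 (by simpa using Nat.lt_of_lt_of_le one_pos hL) o none
    simp only [Pi.zero_apply, pow_zero, Finset.prod_const_one, Finset.sum_const,
      nsmul_eq_mul, mul_one] at h
    exact_mod_cast h
  -- The number of pairs (permutation, encoding): balance for the constant monomial gives all `V o`
  -- the same size, so the normalization is independent of `x`.
  set K : ℝ := Fintype.card (Equiv.Perm (Fin N)) * (#(V none) : ℝ) ^ N with hK
  have hKpos : 0 < K := by
    have h1 : (0 : ℝ) < #(V none) := by exact_mod_cast (hne none).card_pos
    have h2 : (0 : ℝ) < Fintype.card (Equiv.Perm (Fin N)) := by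
      exact_mod_cast Fintype.card_pos
    positivity
  obtain ⟨q, hq, hqe⟩ := (isPolyOn_symmetrization hL e V hbal v hv p).const_mul K⁻¹
  refine ⟨q, (Nat.mul_le_mul_right L hq).trans (Nat.div_mul_le_self _ _), fun x => ?_⟩
  have hsum : ∀ c : ℝ, ∑ σ : Equiv.Perm (Fin N),
      ∑ _y ∈ Fintype.piFinset fun j => V (v x.1 (σ j)), c = K * c := fun c => by
    simp only [Finset.sum_const, Fintype.card_piFinset, hcard, Finset.prod_const,
      Finset.card_univ, Fintype.card_fin, nsmul_eq_mul, hK]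
    push_cast
    ring
  rw [hqe x.1 x.2, ← mul_le_mul_iff_right₀ hKpos, ← abs_of_pos hKpos, ← abs_mul, abs_of_pos hKpos,
    mul_sub, mul_inv_cancel_left₀ hKpos.ne', ← hsum, ← hsum, ← Finset.sum_sub_distrib]
  refine (Finset.abs_sum_le_sum_abs _ _).trans (Finset.sum_le_sum fun σ _ => ?_)
  rw [← Finset.sum_sub_distrib]
  refine (Finset.abs_sum_le_sum_abs _ _).trans (Finset.sum_le_sum fun y hy => ?_)
  have hw : ∀ i, #{j | v x.1 (σ j) = some i} = #{j | x.1 (i, j) = -1} := fun i => by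
    rw [← hv x.1 x.2 i]
    exact Finset.card_equiv σ (by simp)
  have hb := blockLift_literalInput e V hdisj F x.1 (fun j => v x.1 (σ j)) hw y
    (Fintype.mem_piFinset.1 hy)
  rw [promiseComp, ← hb]
  exact hp _

/-! ### Parameters and assembly. -/

theorem two_pow_clog_le {R : ℕ} (hR : 1 ≤ R) : 2 ^ Nat.clog 2 (R + 1) ≤ 2 * R := by
  have h1 : 0 < Nat.clog 2 (R + 1) := Nat.clog_pos (by norm_num) (by omega)
  have h2 := Nat.pow_pred_clog_lt_self (b := 2) (by norm_num) (x := R + 1) (by omega)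
  obtain ⟨l, hl⟩ := Nat.exists_eq_succ_of_ne_zero h1.ne'
  rw [hl] at h2 ⊢
  rw [Nat.pred_succ] at h2
  rw [pow_succ]
  omega

end ApproxDegree

theorem mainTheorem5 :
    ∃ C : ℕ, ∀ (N R : ℕ), 1 ≤ N → 1 ≤ R → ∀ F : (Fin R → ℤˣ) → ℤˣ,
      ∃ g : (Fin (12 * N * Nat.clog 2 (R + 1)) → ℤˣ) → ℤˣ,
        (∀ ε : ℝ, 0 ≤ ε →
          ApproxDegree.approxDeg (ApproxDegree.lowWeight N R) (ApproxDegree.promiseComp N R F) ε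
              * (Nat.clog 2 (R + 1) : ℕ∞)
            ≤ ApproxDegree.approxDegTotal g ε) ∧
        (∀ (s : ℕ) (c : ApproxDegree.Circuit R s) (o : Fin s), c.Computes o F →
          ∃ (s' : ℕ) (c' : ApproxDegree.Circuit (12 * N * Nat.clog 2 (R + 1)) s') (o' : Fin s'),
            c'.Computes o' g ∧ c'.depth o' ≤ c.depth o + 2 ∧ s' ≤ C * s * N * R ^ 12) ∧
        (∀ (s : ℕ) (c : ApproxDegree.Circuit R s) (o : Fin s), c.Computes o F → c.IsMonotone →
          ∃ (s' : ℕ) (c' : ApproxDegree.Circuit (12 * N * Nat.clog 2 (R + 1)) s') (o' : Fin s'),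
            c'.Computes o' g ∧ c'.IsMonotone ∧ c'.AndAtBottom ∧
              c'.depth o' ≤ c.depth o + 2 ∧ s' ≤ C * s * N * R ^ 12) ∧
        (∀ T : ApproxDegree.MonotoneDNF R, (∀ x, T.eval x = F x) →
          ∃ T' : ApproxDegree.MonotoneDNF (12 * N * Nat.clog 2 (R + 1)),
            (∀ y, T'.eval y = g y) ∧ T'.width ≤ C * T.width * Nat.clog 2 (R + 1)) := by
  -- The size bound needs 12·2 + 64 + 1 = 89, the width bound only 6.
  refine ⟨100, fun N R hN hR F => ?_⟩
  have h2L := ApproxDegree.two_pow_clog_le hR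
  have hRL : R + 1 ≤ 2 ^ Nat.clog 2 (R + 1) := Nat.le_pow_clog (by norm_num) _
  have hL : 1 ≤ Nat.clog 2 (R + 1) := Nat.clog_pos (by norm_num) (by omega)
  generalize Nat.clog 2 (R + 1) = L at h2L hRL hL ⊢
  obtain ⟨H, hH⟩ := ApproxDegree.exists_balanced_fibers hL
  -- There are R + 1 labels, the R block indices and the padding symbol; hence log(R+1).
  obtain ⟨ι⟩ : Nonempty (Option (Fin R) ↪ (Fin L → ℤˣ)) := by
    refine Function.Embedding.nonempty_of_card_le ?_
    simpa [Fintype.card_units_int] using hRL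
  let V : Option (Fin R) → Finset (Fin (6 * L) → ℤˣ) := fun o => {y | H y = ι o}
  have hdisj : ∀ o o' y, y ∈ V o → y ∈ V o' → o = o' := fun o o' y h h' => by
    simp only [V, Finset.mem_filter, Finset.mem_univ, true_and] at h h'
    exact ι.injective (h.symm.trans h')
  have hbal : ∀ k : Fin (6 * L) → ℕ, ∑ b, k b < L → ∀ o o',
      ∑ y ∈ V o, ∏ b, (y b : ℤ) ^ k b = ∑ y ∈ V o', ∏ b, (y b : ℤ) ^ k b := fun k hk o o' =>
    mul_left_cancel₀ (pow_ne_zero L two_ne_zero) ((hH k hk (ι o)).trans (hH k hk (ι o')).symm)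
  have hne : ∀ o, (V o).Nonempty := fun o => by
    rw [Finset.nonempty_iff_ne_empty]
    intro h
    have h0 := hH 0 (by simpa using Nat.lt_of_lt_of_le one_pos hL) (ι o)
    rw [show Finset.univ.filter (fun y => H y = ι o) = ∅ from h] at h0
    simp [Fintype.card_units_int] at h0
    exact pow_ne_zero _ two_ne_zero h0.symm
  obtain ⟨e⟩ : Nonempty (Fin (12 * N * L) ≃ Fin N × Fin (6 * L) × Bool) := by
    refine ⟨(Fintype.equivFinOfCardEq ?_).symm⟩
    simp only [Fintype.card_prod, Fintype.card_fin, Fintype.card_bool]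
    ring
  have hsize : ∀ s, 1 ≤ s → 12 * N * L + N * 2 ^ (6 * L) + s ≤ 100 * s * N * R ^ 12 := by
    intro s hs
    have h1 : L ≤ 2 * R := Nat.lt_two_pow_self.le.trans h2L
    have h2 : 2 ^ (6 * L) ≤ 64 * R ^ 12 := by
      calc 2 ^ (6 * L) = (2 ^ L) ^ 6 := by rw [← pow_mul, mul_comm]
        _ ≤ (2 * R) ^ 6 := Nat.pow_le_pow_left h2L 6
        _ = 64 * R ^ 6 := by ring
        -- The construction gives exponent 6; it is relaxed to the stated 12.
        _ ≤ 64 * R ^ 12 := Nat.mul_le_mul_left _ (Nat.pow_le_pow_right hR (by norm_num))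
    have h3 : R ≤ R ^ 12 := Nat.le_self_pow (by norm_num) R
    have h4 : N * R ^ 12 ≤ s * (N * R ^ 12) := Nat.le_mul_of_pos_left _ hs
    have h5 : s ≤ s * (N * R ^ 12) := Nat.le_mul_of_pos_right _ (by positivity)
    have h6 : N * L ≤ N * (2 * R ^ 12) := Nat.mul_le_mul_left _ (by omega)
    have h7 : N * 2 ^ (6 * L) ≤ N * (64 * R ^ 12) := Nat.mul_le_mul_left _ h2
    nlinarith
  refine ⟨ApproxDegree.blockLift e (fun i => V (some i)) F, fun ε _ => ?_, fun s c o hc => ?_,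
    fun s c o hc hm => ?_, fun T hT => ?_⟩
  · refine le_iInf₂ fun p hp => ?_
    obtain ⟨q, hq, hqe⟩ := ApproxDegree.exists_approx_promiseComp hL e V hdisj hne hbal F ε p
      fun Y => hp ⟨Y, trivial⟩
    calc _ ≤ (q.totalDegree : ℕ∞) * (L : ℕ∞) := by
          gcongr
          exact iInf₂_le q hqe
      _ ≤ (p.totalDegree : ℕ∞) := by exact_mod_cast hq
  · obtain ⟨c', o', h1, h2, -⟩ :=
      ApproxDegree.exists_circuit_blockLift e (fun i => V (some i)) F c o hc
    exact ⟨_, c', o', h1, h2, hsize s o.pos⟩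
  · obtain ⟨c', o', h1, h2, h3⟩ :=
      ApproxDegree.exists_circuit_blockLift e (fun i => V (some i)) F c o hc
    exact ⟨_, c', o', h1, (h3 hm).1, (h3 hm).2, h2, hsize s o.pos⟩
  · obtain ⟨T', h1, h2⟩ :=
      ApproxDegree.exists_monotoneDNF_blockLift hN e (fun i => V (some i)) F T hT
    refine ⟨T', h1, h2.trans ?_⟩
    calc T.width * (6 * L) = 6 * (T.width * L) := by ring
      _ ≤ 100 * (T.width * L) := Nat.mul_le_mul_right _ (by norm_num)
      _ = 100 * T.width * L := by ring
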